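/- Conventions. All logarithms are natural. For random elements $U,V$ on a probability space, $I(U;V)=D_{\rm KL}(P_{U,V}\,\|\,P_U\otimes P_V)\in[0,\infty]$ is their mutual information, and $I(U;V|T)=\int I(U;V|T=t)\,P_T(dt)\in[0,\infty]$ is the conditional mutual information, where $I(U;V|T=t)$ is the mutual information of the coordinates under the regular conditional law $P_{U,V|T=t}$. For a loss function $\ell:\mathcal Y\times\mathcal A\to\mathbb R$, the Bayes risk of predicting $Y$ from $V$ is $R_\ell(Y|V)=\inf_\psi \mathbb E[\ell(Y,\psi(V))]$, the infimum being over all measurable decision rules $\psi:\mathcal V\to\mathcal A$ for which the expectation exists. The convention $0\cdot\infty=0$ is used. All functions below are measurable. Model. Let $\mathcal X,\mathcal W$ be measurable spaces, and let the space $\mathcal Y$ of the quantity to be predicted and the action space $\mathcal A$ be standard Borel. Let $P_W$ be a prior distribution on $\mathcal W$, let $P_{Z|W}$ be a probability kernel from $\mathcal W$ to $\mathcal Z=\mathcal X\times\mathcal Y$, and let $n\ge 0$. The parameter $W$, the data $Z^n=(Z_1,\dots,Z_n)$ and the fresh pair $Z=(X,Y)$ have joint distribution $$P_{W,Z^n,Z}=P_W\Big(\prod_{i=1}^n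 P_{Z_i|W}\Big)P_{Z|W},\qquad P_{Z_i|W}=P_{Z|W}.$$ The minimum excess risk is ${\rm MER}_\ell=R_\ell(Y|X,Z^n)-R_\ell(Y|X,W)$. Theorem. Let $b\in\mathbb R$, let $\ell:\mathcal Y\times\mathcal A\to[0,b]$, and suppose that there is a function $g:\mathcal X\times\mathcal W\to\mathcal A$ (for instance a generative function $g:\mathcal X\times\mathcal W\to\mathcal Y$, when $\mathcal A=\mathcal Y$) such that $\ell(Y,g(X,W))=0$ almost surely with respect to $P_{W,X,Y}$. Then $${\rm MER}_\ell\le\frac{b}{\log 2}\,I(g(X,W);Y\,|\,X,Z^n).$$ Lemma. Let $V$ and $Y$ be jointly distributed random elements of measurable spaces $\mathcal V$ and $\mathcal Y$, and let $V'$ be an independent copy of $V$: $P_{V'}=P_V$ and $V'$ is independent of $(V,Y)$. Let $\ell:\mathcal Y\times\mathcal V\to[0,b]$. If $\ell(Y,V)=0$ almost surely, then $$\mathbb E[\ell(Y,V')]\le\frac{b}{\log 2}\,I(V;Y).$$ -/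

import Mathlib

open MeasureTheory ProbabilityTheory

open scoped ENNReal

namespace BayesLearning

section Model

/-- The conditional law `∏ i, P_{Z_i|W}` of `n` samples that are i.i.d. with law `K w` given
`W = w`. -/
noncomputable def iidKernel {𝒲 𝒵 : Type*} [MeasurableSpace 𝒲] [MeasurableSpace 𝒵]
    (K : Kernel 𝒲 𝒵) [IsMarkovKernel K] (n : ℕ) : Kernel 𝒲 (Fin n → 𝒵) where
  toFun w := Measure.pi fun _ : Fin n => K w
  measurable' := by
    refine Measurable.measure_of_isPiSystem_of_isProbabilityMeasure
      (S := Set.pi Set.univ '' Set.pi Set.univ fun _ : Fin n => {s : Set 𝒵 | MeasurableSet s})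
      generateFrom_pi.symm isPiSystem_pi ?_
    rintro _ ⟨s, hs, rfl⟩
    simp only [Measure.pi_pi]
    exact Finset.measurable_prod _ fun i _ => K.measurable_coe (hs i (Set.mem_univ i))

instance {𝒲 𝒵 : Type*} [MeasurableSpace 𝒲] [MeasurableSpace 𝒵]
    (K : Kernel 𝒲 𝒵) [IsMarkovKernel K] (n : ℕ) : IsMarkovKernel (iidKernel K n) :=
  ⟨fun w => inferInstanceAs (IsProbabilityMeasure (Measure.pi fun _ : Fin n => K w))⟩

/-- The joint law `P_{W,Zⁿ,Z} = P_W (∏ i, P_{Z_i|W}) P_{Z|W}` of the parameter `W`, the data `Zⁿ`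
and the fresh pair `Z`, where the prior is `P_W = prior` and the model is
`P_{Z|W} = P_{Z_i|W} = K`. -/
noncomputable def jointLaw {𝒲 𝒵 : Type*} [MeasurableSpace 𝒲] [MeasurableSpace 𝒵]
    (prior : Measure 𝒲) (K : Kernel 𝒲 𝒵) [IsMarkovKernel K] (n : ℕ) :
    Measure (𝒲 × (Fin n → 𝒵) × 𝒵) :=
  prior.compProd ((iidKernel K n).prod K)

end Model

section Risk

/-- The Bayes risk `R_ℓ(Y|V) = inf_ψ E[ℓ(Y, ψ(V))]`, the infimum being over the (deterministic,
measurable) decision rules `ψ : 𝒱 → 𝒜` for which the expectation exists. -/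
noncomputable def bayesRisk {Ω 𝒴 𝒱 𝒜 : Type*} [MeasurableSpace Ω] [MeasurableSpace 𝒱]
    [MeasurableSpace 𝒜] (P : Measure Ω) (ℓ : 𝒴 → 𝒜 → ℝ) (Y : Ω → 𝒴) (V : Ω → 𝒱) : ℝ :=
  ⨅ ψ : {ψ : 𝒱 → 𝒜 // Measurable ψ ∧ Integrable (fun ω => ℓ (Y ω) (ψ (V ω))) P},
    ∫ ω, ℓ (Y ω) (ψ.1 (V ω)) ∂P

/-- The minimum excess risk `MER_ℓ = R_ℓ(Y|X,Zⁿ) - R_ℓ(Y|X,W)`. -/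
noncomputable def minExcessRisk {Ω 𝒳 𝒴 𝒲 𝒜 : Type*} [MeasurableSpace Ω] [MeasurableSpace 𝒳]
    [MeasurableSpace 𝒴] [MeasurableSpace 𝒲] [MeasurableSpace 𝒜] {n : ℕ} (P : Measure Ω)
    (ℓ : 𝒴 → 𝒜 → ℝ) (W : Ω → 𝒲) (Zs : Ω → Fin n → 𝒳 × 𝒴) (X : Ω → 𝒳) (Y : Ω → 𝒴) : ℝ :=
  bayesRisk P ℓ Y (fun ω => (X ω, Zs ω)) - bayesRisk P ℓ Y (fun ω => (X ω, W ω))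

end Risk

section Information

/-- The mutual information `I(U;V) = D_KL(P_{U,V} ‖ P_U ⊗ P_V)`, in nats. -/
noncomputable def mutualInfo {Ω 𝒰 𝒱 : Type*} [MeasurableSpace Ω] [MeasurableSpace 𝒰]
    [MeasurableSpace 𝒱] (P : Measure Ω) (U : Ω → 𝒰) (V : Ω → 𝒱) : ℝ≥0∞ :=
  InformationTheory.klDiv (P.map fun ω => (U ω, V ω)) ((P.map U).prod (P.map V))

/-- The conditional mutual information `I(U;V|T) = ∫ I(U;V|T=t) P_T(dt)`, in nats, where
`I(U;V|T=t)` is the mutual information of the two coordinates under the regular conditional law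
of `(U, V)` given `T = t`. -/
noncomputable def condMutualInfo {Ω 𝒰 𝒱 𝒯 : Type*} [MeasurableSpace Ω]
    [MeasurableSpace 𝒰] [StandardBorelSpace 𝒰] [Nonempty 𝒰]
    [MeasurableSpace 𝒱] [StandardBorelSpace 𝒱] [Nonempty 𝒱] [MeasurableSpace 𝒯]
    (P : Measure Ω) [IsFiniteMeasure P] (U : Ω → 𝒰) (V : Ω → 𝒱) (T : Ω → 𝒯) : ℝ≥0∞ :=
  ∫⁻ t, mutualInfo (condDistrib (fun ω => (U ω, V ω)) T P t) Prod.fst Prod.snd ∂(P.map T)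

end Information

end BayesLearning

namespace BayesLearning

/-! The divergence of `μ` from `ν` integrates `klFun (dμ/dν) ≥ 0` against `ν`, and `klFun 0 = 1`. A
loss vanishing `μ`-a.e. lives, up to a `ν`-null set, where the density is zero, so it is dominated
pointwise by `b * klFun (dμ/dν)`. This gives decoupling even with the constant `b ≤ b / log 2`. For
the risk bound, set `T = (X, Zⁿ)` and sample an action from the conditional law of `g(X, W)` given
`T`, independently of `Y`. Decoupling under each conditional law bounds the cost of this posterior
sampling; derandomizing it yields a decision rule. -/

/-- If `f ≤ c` vanishes `μ`-almost everywhere, then its integral against `ν` is at most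
`c` times the divergence of `μ` from `ν`. -/
theorem lintegral_le_mul_klDiv {α : Type*} [MeasurableSpace α] (μ ν : Measure α)
    [IsFiniteMeasure μ] [IsFiniteMeasure ν] {f : α → ℝ≥0∞} {c : ℝ≥0∞} (hc : c ≠ ∞)
    (hfc : ∀ x, f x ≤ c) (hf : ∀ᵐ x ∂μ, f x = 0) :
    ∫⁻ x, f x ∂ν ≤ c * InformationTheory.klDiv μ ν := by
  by_cases hac : μ ≪ ν
  · rw [InformationTheory.klDiv_eq_lintegral_klFun_of_ac hac, ← lintegral_const_mul' _ _ hc]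
    -- This turns `hf` into: for `ν`-almost every `x`, a nonzero density at `x` forces `f x = 0`.
    rw [← Measure.withDensity_rnDeriv_eq μ ν hac,
      ae_withDensity_iff (Measure.measurable_rnDeriv μ ν)] at hf
    refine lintegral_mono_ae ?_
    filter_upwards [hf] with x hx
    by_cases h0 : μ.rnDeriv ν x = 0
    · simpa [h0, InformationTheory.klFun] using hfc x
    · simp [hx h0]
  · rw [InformationTheory.klDiv_of_not_ac hac]
    -- The divergence is `∞` here, but `0 * ∞ = 0`, so `c = 0` needs its own argument.
    rcases eq_or_ne c 0 with rfl | h0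
    · simp [fun x => le_antisymm (hfc x) bot_le]
    · simp [ENNReal.mul_top h0]

theorem ofReal_le_ofReal_div_log_two {b : ℝ} (hb : 0 ≤ b) :
    ENNReal.ofReal b ≤ ENNReal.ofReal (b / Real.log 2) := by
  refine ENNReal.ofReal_le_ofReal (le_div_self hb (Real.log_pos one_lt_two) ?_)
  linarith [Real.log_two_lt_d9]

/-- **Decoupling**: a loss that vanishes almost surely under the joint law of `(V, Y)` has, under
the product of the marginals, a mean of at most `b / log 2` times the mutual information. -/
theorem lintegral_prod_le_mul_mutualInfo {Ω 𝒱 𝒴 : Type*} [MeasurableSpace Ω] [MeasurableSpace 𝒱]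
    [MeasurableSpace 𝒴] (P : Measure Ω) [IsProbabilityMeasure P] {V : Ω → 𝒱} {Y : Ω → 𝒴}
    (hV : AEMeasurable V P) (hY : AEMeasurable Y P) {b : ℝ} {ℓ : 𝒴 → 𝒱 → ℝ}
    (hℓ : Measurable (Function.uncurry ℓ)) (hb : ∀ y v, ℓ y v ∈ Set.Icc 0 b)
    (h0 : ∀ᵐ ω ∂P, ℓ (Y ω) (V ω) = 0) :
    ∫⁻ p : 𝒱 × 𝒴, ENNReal.ofReal (ℓ p.2 p.1) ∂(P.map V).prod (P.map Y) ≤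
      ENNReal.ofReal (b / Real.log 2) * mutualInfo P V Y := by
  have hm : Measurable fun p : 𝒱 × 𝒴 => ℓ p.2 p.1 := hℓ.comp measurable_swap
  have hb0 : 0 ≤ b := by
    obtain ⟨ω⟩ := nonempty_of_isProbabilityMeasure P
    exact (hb (Y ω) (V ω)).1.trans (hb (Y ω) (V ω)).2
  refine (lintegral_le_mul_klDiv (P.map fun ω => (V ω, Y ω)) _ ENNReal.ofReal_ne_top
    (fun p => ENNReal.ofReal_le_ofReal (hb p.2 p.1).2) ?_).trans
      (mul_le_mul_left (ofReal_le_ofReal_div_log_two hb0) _)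
  rw [ae_map_iff (hV.prodMk hY) (measurableSet_eq_fun hm.ennreal_ofReal measurable_const)]
  filter_upwards [h0] with ω hω
  simp [hω]

theorem integral_independent_copy_le_mutualInfo {Ω 𝒱 𝒴 : Type*} [MeasurableSpace Ω]
    [MeasurableSpace 𝒱] [MeasurableSpace 𝒴] (P : Measure Ω) [IsProbabilityMeasure P]
    {V V' : Ω → 𝒱} {Y : Ω → 𝒴} (hV : AEMeasurable V P) (hY : AEMeasurable Y P)
    (hid : IdentDistrib V' V P P) (hind : IndepFun V' (fun ω => (V ω, Y ω)) P)
    {b : ℝ} {ℓ : 𝒴 → 𝒱 → ℝ} (hℓ : Measurable (Function.uncurry ℓ))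
    (hb : ∀ y v, ℓ y v ∈ Set.Icc 0 b) (h0 : ∀ᵐ ω ∂P, ℓ (Y ω) (V ω) = 0) :
    ENNReal.ofReal (∫ ω, ℓ (Y ω) (V' ω) ∂P) ≤
      ENNReal.ofReal (b / Real.log 2) * mutualInfo P V Y := by
  have hV' := hid.aemeasurable_fst
  have hm : Measurable fun p : 𝒱 × 𝒴 => ℓ p.2 p.1 := hℓ.comp measurable_swap
  have hlaw : P.map (fun ω => (V' ω, Y ω)) = (P.map V).prod (P.map Y) := by
    rw [← hid.map_eq]
    exact (indepFun_iff_map_prod_eq_prod_map_map hV' hY).1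
      (hind.comp measurable_id measurable_snd)
  refine le_trans (le_of_eq ?_) (lintegral_prod_le_mul_mutualInfo P hV hY hℓ hb h0)
  rw [← hlaw, lintegral_map' hm.ennreal_ofReal.aemeasurable (hV'.prodMk hY)]
  refine ofReal_integral_eq_lintegral_ofReal ?_ (ae_of_all _ fun ω => (hb _ _).1)
  exact Integrable.of_mem_Icc 0 b (hm.comp_aemeasurable (hV'.prodMk hY))
    (ae_of_all _ fun ω => hb _ _)

/-- A randomized decision rule can be replaced by a deterministic one whose mean cost is not
larger. -/
theorem exists_measurable_lintegral_le_lintegral_kernel {𝒯 𝒜 : Type*} [MeasurableSpace 𝒯]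
    [MeasurableSpace 𝒜] [StandardBorelSpace 𝒜] [Nonempty 𝒜] (μ : Measure 𝒯) [SFinite μ]
    (κ : Kernel 𝒯 𝒜) [IsMarkovKernel κ] {F : 𝒯 → 𝒜 → ℝ≥0∞}
    (hF : Measurable (Function.uncurry F)) :
    ∃ ψ : 𝒯 → 𝒜, Measurable ψ ∧ ∫⁻ t, F t (ψ t) ∂μ ≤ ∫⁻ t, ∫⁻ a, F t a ∂κ t ∂μ := by
  -- On a standard Borel space a kernel is the law of `h t u` with `u` uniform. One seed `u`, shared
  -- by all `t`, does no worse than the average.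
  obtain ⟨h, hh, hκ⟩ := κ.exists_measurable_map_eq_unitInterval
  have hFh : Measurable fun p : 𝒯 × unitInterval => F p.1 (h p.1 p.2) :=
    hF.comp (measurable_fst.prodMk hh)
  have hswap : ∫⁻ t, ∫⁻ a, F t a ∂κ t ∂μ =
      ∫⁻ u : unitInterval, ∫⁻ t, F t (h t u) ∂μ := by
    rw [← lintegral_lintegral_swap hFh.aemeasurable]
    refine lintegral_congr fun t => ?_
    rw [← hκ t, lintegral_map hF.of_uncurry_left hh.of_uncurry_left]
  obtain ⟨u, hu⟩ := exists_le_lintegral (μ := (volume : Measure unitInterval))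
    (f := fun u => ∫⁻ t, F t (h t u) ∂μ) hFh.lintegral_prod_left'.aemeasurable
  exact ⟨fun t => h t u, hh.of_uncurry_right, hswap ▸ hu⟩

/-- Some deterministic decision rule `ψ` based on `T` has a mean loss of at most `b / log 2` times
the conditional mutual information between `Y` and a lossless action `U` given `T`. -/
theorem exists_measurable_lintegral_le_condMutualInfo {Ω 𝒴 𝒯 𝒜 : Type*} [MeasurableSpace Ω]
    [MeasurableSpace 𝒯] [MeasurableSpace 𝒴] [StandardBorelSpace 𝒴] [Nonempty 𝒴]
    [MeasurableSpace 𝒜] [StandardBorelSpace 𝒜] [Nonempty 𝒜]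
    (P : Measure Ω) [IsProbabilityMeasure P] {U : Ω → 𝒜} {Y : Ω → 𝒴} {T : Ω → 𝒯}
    (hU : AEMeasurable U P) (hY : AEMeasurable Y P) (hT : AEMeasurable T P)
    {b : ℝ} {ℓ : 𝒴 → 𝒜 → ℝ} (hℓ : Measurable (Function.uncurry ℓ))
    (hb : ∀ y a, ℓ y a ∈ Set.Icc 0 b) (h0 : ∀ᵐ ω ∂P, ℓ (Y ω) (U ω) = 0) :
    ∃ ψ : 𝒯 → 𝒜, Measurable ψ ∧ ∫⁻ ω, ENNReal.ofReal (ℓ (Y ω) (ψ (T ω))) ∂P ≤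
      ENNReal.ofReal (b / Real.log 2) * condMutualInfo P U Y T := by
  have hUY : AEMeasurable (fun ω => (U ω, Y ω)) P := hU.prodMk hY
  set κ := condDistrib (fun ω => (U ω, Y ω)) T P
  have hlaw : (P.map T) ⊗ₘ κ = P.map fun ω => (T ω, (U ω, Y ω)) := compProd_map_condDistrib hUY
  have hm : Measurable fun p : 𝒜 × 𝒴 => ℓ p.2 p.1 := hℓ.comp measurable_swap
  have hzero : ∀ᵐ t ∂P.map T, ∀ᵐ p ∂κ t, ℓ p.2 p.1 = 0 := by
    refine Measure.ae_ae_of_ae_compProd (p := fun q : 𝒯 × 𝒜 × 𝒴 => ℓ q.2.2 q.2.1 = 0) ?_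
    rw [hlaw]
    exact (ae_map_iff (hT.prodMk hUY)
      (measurableSet_eq_fun (hm.comp measurable_snd) measurable_const)).2 h0
  -- The conditional risk of action `a` given `T = t`. Averaging it over `κ.fst t` gives the cost of
  -- posterior sampling.
  let F : 𝒯 → 𝒜 → ℝ≥0∞ := fun t a => ∫⁻ y, ENNReal.ofReal (ℓ y a) ∂κ.snd t
  have hF : Measurable (Function.uncurry F) := by
    have : Measurable fun q : (𝒯 × 𝒜) × 𝒴 => ENNReal.ofReal (ℓ q.2 q.1.2) :=
      (hℓ.comp (measurable_snd.prodMk measurable_fst.snd)).ennreal_ofReal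
    exact this.lintegral_kernel_prod_right' (κ := κ.snd.comap Prod.fst measurable_fst)
  obtain ⟨ψ, hψ, hle⟩ := exists_measurable_lintegral_le_lintegral_kernel (P.map T) κ.fst hF
  refine ⟨ψ, hψ, ?_⟩
  have hcost : ∫⁻ ω, ENNReal.ofReal (ℓ (Y ω) (ψ (T ω))) ∂P = ∫⁻ t, F t (ψ t) ∂P.map T := by
    have hmψ : Measurable fun q : 𝒯 × 𝒜 × 𝒴 => ENNReal.ofReal (ℓ q.2.2 (ψ q.1)) :=
      (hℓ.comp (measurable_snd.snd.prodMk (hψ.comp measurable_fst))).ennreal_ofReal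
    have hpush := lintegral_map' hmψ.aemeasurable (hT.prodMk hUY)
    rw [← hlaw, Measure.lintegral_compProd hmψ] at hpush
    rw [← hpush]
    refine lintegral_congr fun t => ?_
    simp only [F, Kernel.snd_apply]
    rw [lintegral_map (hℓ.of_uncurry_right.ennreal_ofReal) measurable_snd]
  rw [hcost]
  refine hle.trans ?_
  rw [condMutualInfo, ← lintegral_const_mul' _ _ ENNReal.ofReal_ne_top]
  refine lintegral_mono_ae ?_
  filter_upwards [hzero] with t ht
  -- Decoupling with `κ t` as the underlying probability measure and the two coordinates as the
  -- random elements.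
  have key := lintegral_prod_le_mul_mutualInfo (κ t) measurable_fst.aemeasurable
    measurable_snd.aemeasurable hℓ hb ht
  refine le_trans (le_of_eq ?_) key
  rw [lintegral_prod _ hm.ennreal_ofReal.aemeasurable, Kernel.fst_apply]
  simp only [F, Kernel.snd_apply]

theorem bayesRisk_nonneg {Ω 𝒴 𝒱 𝒜 : Type*} [MeasurableSpace Ω] [MeasurableSpace 𝒱]
    [MeasurableSpace 𝒜] (P : Measure Ω) {ℓ : 𝒴 → 𝒜 → ℝ} (hℓ : ∀ y a, 0 ≤ ℓ y a) (Y : Ω → 𝒴)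
    (V : Ω → 𝒱) : 0 ≤ bayesRisk P ℓ Y V :=
  Real.iInf_nonneg fun _ => integral_nonneg fun _ => hℓ _ _

theorem bayesRisk_le {Ω 𝒴 𝒱 𝒜 : Type*} [MeasurableSpace Ω] [MeasurableSpace 𝒱]
    [MeasurableSpace 𝒜] (P : Measure Ω) {ℓ : 𝒴 → 𝒜 → ℝ} (hℓ : ∀ y a, 0 ≤ ℓ y a) (Y : Ω → 𝒴)
    (V : Ω → 𝒱) {ψ : 𝒱 → 𝒜} (hψ : Measurable ψ)
    (hint : Integrable (fun ω => ℓ (Y ω) (ψ (V ω))) P) :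
    bayesRisk P ℓ Y V ≤ ∫ ω, ℓ (Y ω) (ψ (V ω)) ∂P :=
  ciInf_le (f := fun ψ : {ψ : 𝒱 → 𝒜 // Measurable ψ ∧
      Integrable (fun ω => ℓ (Y ω) (ψ (V ω))) P} => ∫ ω, ℓ (Y ω) (ψ.1 (V ω)) ∂P)
    ⟨0, by rintro _ ⟨_, rfl⟩; exact integral_nonneg fun _ => hℓ _ _⟩ ⟨ψ, hψ, hint⟩

theorem minExcessRisk_le_condMutualInfo {Ω 𝒳 𝒴 𝒲 𝒜 : Type*} [MeasurableSpace Ω]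
    [MeasurableSpace 𝒳] [MeasurableSpace 𝒲]
    [MeasurableSpace 𝒴] [StandardBorelSpace 𝒴] [Nonempty 𝒴]
    [MeasurableSpace 𝒜] [StandardBorelSpace 𝒜] [Nonempty 𝒜]
    (P : Measure Ω) [IsProbabilityMeasure P] {n : ℕ}
    {W : Ω → 𝒲} {Zs : Ω → Fin n → 𝒳 × 𝒴} {X : Ω → 𝒳} {Y : Ω → 𝒴}
    (hW : AEMeasurable W P) (hZs : AEMeasurable Zs P) (hX : AEMeasurable X P)
    (hY : AEMeasurable Y P) {b : ℝ} {ℓ : 𝒴 → 𝒜 → ℝ} (hℓ : Measurable (Function.uncurry ℓ))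
    (hb : ∀ y a, ℓ y a ∈ Set.Icc 0 b) {g : 𝒳 → 𝒲 → 𝒜} (hg : Measurable (Function.uncurry g))
    (h0 : ∀ᵐ ω ∂P, ℓ (Y ω) (g (X ω) (W ω)) = 0) :
    ENNReal.ofReal (minExcessRisk P ℓ W Zs X Y) ≤ ENNReal.ofReal (b / Real.log 2) *
      condMutualInfo P (fun ω => g (X ω) (W ω)) Y (fun ω => (X ω, Zs ω)) := by
  have hT : AEMeasurable (fun ω => (X ω, Zs ω)) P := hX.prodMk hZs
  have hpos : ∀ y a, 0 ≤ ℓ y a := fun y a => (hb y a).1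
  obtain ⟨ψ, hψ, hle⟩ := exists_measurable_lintegral_le_condMutualInfo P
    (hg.comp_aemeasurable (hX.prodMk hW)) hY hT hℓ hb h0
  have hint : Integrable (fun ω => ℓ (Y ω) (ψ (X ω, Zs ω))) P :=
    Integrable.of_mem_Icc 0 b
      (hℓ.comp_aemeasurable (hY.prodMk (hψ.comp_aemeasurable hT)))
      (ae_of_all _ fun ω => hb _ _)
  refine le_trans ?_ hle
  rw [← ofReal_integral_eq_lintegral_ofReal hint (ae_of_all _ fun ω => hpos _ _)]
  -- The subtracted risk `R_ℓ(Y|X,W)` is nonnegative and can be dropped.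
  refine ENNReal.ofReal_le_ofReal ((sub_le_self _ (bayesRisk_nonneg P hpos Y _)).trans ?_)
  exact bayesRisk_le P hpos Y _ hψ hint

end BayesLearning

theorem mainTheorem5 :
    -- the bound on the minimum excess risk of a realizable model
    (∀ {Ω 𝒳 𝒴 𝒲 𝒜 : Type*} [MeasurableSpace Ω] [MeasurableSpace 𝒳] [MeasurableSpace 𝒲]
        [MeasurableSpace 𝒴] [StandardBorelSpace 𝒴] [Nonempty 𝒴]
        [MeasurableSpace 𝒜] [StandardBorelSpace 𝒜] [Nonempty 𝒜]
        (P : Measure Ω) [IsProbabilityMeasure P]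
        (prior : Measure 𝒲) [IsProbabilityMeasure prior]
        (K : Kernel 𝒲 (𝒳 × 𝒴)) [IsMarkovKernel K] (n : ℕ)
        (W : Ω → 𝒲) (Zs : Ω → Fin n → 𝒳 × 𝒴) (X : Ω → 𝒳) (Y : Ω → 𝒴),
        HasLaw (fun ω => (W ω, Zs ω, (X ω, Y ω))) (BayesLearning.jointLaw prior K n) P →
      ∀ (b : ℝ) (ℓ : 𝒴 → 𝒜 → ℝ), Measurable (Function.uncurry ℓ) →
        (∀ y a, ℓ y a ∈ Set.Icc 0 b) →
      ∀ g : 𝒳 → 𝒲 → 𝒜, Measurable (Function.uncurry g) →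
        (∀ᵐ ω ∂P, ℓ (Y ω) (g (X ω) (W ω)) = 0) →
      ENNReal.ofReal (BayesLearning.minExcessRisk P ℓ W Zs X Y) ≤
        ENNReal.ofReal (b / Real.log 2) *
          BayesLearning.condMutualInfo P (fun ω => g (X ω) (W ω)) Y (fun ω => (X ω, Zs ω))) ∧
    -- the decoupling lemma
    (∀ {Ω 𝒱 𝒴 : Type*} [MeasurableSpace Ω] [MeasurableSpace 𝒱] [MeasurableSpace 𝒴]
        (P : Measure Ω) [IsProbabilityMeasure P] (V V' : Ω → 𝒱) (Y : Ω → 𝒴),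
        AEMeasurable V P → AEMeasurable Y P → IdentDistrib V' V P P →
        IndepFun V' (fun ω => (V ω, Y ω)) P →
      ∀ (b : ℝ) (ℓ : 𝒴 → 𝒱 → ℝ), Measurable (Function.uncurry ℓ) →
        (∀ y v, ℓ y v ∈ Set.Icc 0 b) →
        (∀ᵐ ω ∂P, ℓ (Y ω) (V ω) = 0) →
      ENNReal.ofReal (∫ ω, ℓ (Y ω) (V' ω) ∂P) ≤
        ENNReal.ofReal (b / Real.log 2) * BayesLearning.mutualInfo P V Y) := by
  refine ⟨?_, ?_⟩
  · intro Ω 𝒳 𝒴 𝒲 𝒜 _ _ _ _ _ _ _ _ _ P _ prior _ K _ n W Zs X Y hlaw b ℓ hℓ hb g hg h0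
    have h := hlaw.aemeasurable
    exact BayesLearning.minExcessRisk_le_condMutualInfo P h.fst h.snd.fst h.snd.snd.fst
      h.snd.snd.snd hℓ hb hg h0
  · intro Ω 𝒱 𝒴 _ _ _ P _ V V' Y hV hY hid hind b ℓ hℓ hb h0
    exact BayesLearning.integral_independent_copy_le_mutualInfo P hV hY hid hind hℓ hb h0
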